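/- For $z=(z_1,z_2,z_3)\in\mathbb{C}^3$ let $\hat\Gamma(z)$ be the symmetric $6\times 6$ complex matrix, indexed by the coordinates $z_1,z_2,z_3,\bar z_1,\bar z_2,\bar z_3$, with entries $$\hat\Gamma(z_i,z_j)=\tfrac32\,\bar z_{c(i,j)}-z_iz_j,\quad \hat\Gamma(\bar z_i,\bar z_j)=\tfrac32\, z_{c(i,j)}-\bar z_i\bar z_j\quad(i\ne j),$$ $$\hat\Gamma(z_i,z_i)=-z_i^2,\quad \hat\Gamma(\bar z_i,\bar z_i)=-\bar z_i^2,\quad \hat\Gamma(z_i,\bar z_j)=\hat\Gamma(\bar z_j,z_i)=\tfrac32\delta_{ij}-\tfrac12 z_i\bar z_j,$$ where, for $i\neq j$, $c(i,j)$ is the element of $\{1,2,3\}$ different from $i$ and $j$. Let $D(z)=\det\hat\Gamma(z)$, and let $\Omega_1$ be the connected component of $\{z\in\mathbb{C}^3: D(z)\neq 0\}$ that contains the origin. Put $$P_1(z)=2-(S_1+1)^2+2S_2+8\,\mathrm{Re}(z_1z_2z_3),\qquad S_1=\sum_{j=1}^3|z_j|^2,\quad S_2=\sum_{j=1}^3|z_j|^4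 .$$ Write $(u_1,\dots,u_6)=(z_1,z_2,z_3,\bar z_1,\bar z_2,\bar z_3)$, let $\partial_{u_a}$ be the corresponding Wirtinger derivatives, and for $\lambda\in\mathbb{R}$ set $$\hat\Gamma(f,g)=\sum_{a,b=1}^6\hat\Gamma(u_a,u_b)\,\partial_{u_a}f\,\partial_{u_b}g,\qquad \hat L^{(\lambda)}f=\sum_{a,b=1}^6\hat\Gamma(u_a,u_b)\,\partial_{u_a}\partial_{u_b}f-\lambda\sum_{a=1}^6u_a\,\partial_{u_a}f .$$ Then $P_1>0$ on $\Omega_1$, and the following hold, where $dx$ is Lebesgue measure on $\Omega_1\subset\mathbb{C}^3\simeq\mathbb{R}^6$. 1. For every real $\beta>-1$, $\int_{\Omega_1}P_1^\beta\,dx<\infty$. 2. For every real $\lambda>5/2$, put $\beta=\frac{2\lambda-11}{6}$ and $C_\beta=\big(\int_{\Omega_1}P_1^\beta\,dx\big)^{-1}$. Then $\mu=C_\beta P_1^\beta\,dx$ is a probability measure on $\Omega_1$, and $\hat L^{(\lambda)}$ is reversible with respect to $\mu$: for all complex-valued (in particular, all real-valued) functions $f,g$ that are $C^\infty$ in the real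 sense on a neighborhood of $\overline{\Omega_1}$, with no boundary condition, the functions $f\,\hat L^{(\lambda)}g$, $g\,\hat L^{(\lambda)}f$ and $\hat\Gamma(f,g)$ are $\mu$-integrable, and $$\int f\,\hat L^{(\lambda)}g\,d\mu=\int g\,\hat L^{(\lambda)}f\,d\mu=-\int\hat\Gamma(f,g)\,d\mu .$$ -/

import Mathlib

open MeasureTheory
open scoped ContDiff ComplexConjugate

noncomputable section

namespace DeltoidModel

/-- Points of `ℂ³`. The measure `volume` on this type is Lebesgue measure on `ℂ³ = ℝ⁶`. -/
abbrev C3 : Type := Fin 3 → ℂ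

/-- Labels of the six coordinate functions: `Sum.inl p` stands for `z_p`, and
`Sum.inr p` for its conjugate. -/
abbrev Idx : Type := Fin 3 ⊕ Fin 3

/-- The coordinate functions `z_p` and `conj z_p`. -/
def coord : Idx → C3 → ℂ
  | Sum.inl p, z => z p
  | Sum.inr p, z => conj (z p)

/-- The Wirtinger derivatives `∂/∂z_p = (∂/∂x_p - i ∂/∂y_p) / 2` and
`∂/∂(conj z_p) = (∂/∂x_p + i ∂/∂y_p) / 2`, where `z_p = x_p + i y_p`. -/
def wirtinger : Idx → (C3 → ℂ) → C3 → ℂ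
  | Sum.inl p, f, z => (1 / 2 : ℂ) *
      (fderiv ℝ f z (Pi.single p 1) - Complex.I * fderiv ℝ f z (Pi.single p Complex.I))
  | Sum.inr p, f, z => (1 / 2 : ℂ) *
      (fderiv ℝ f z (Pi.single p 1) + Complex.I * fderiv ℝ f z (Pi.single p Complex.I))

/-- For `i ≠ j`, the index different from `i` and `j` (arithmetic is modulo 3). -/
def third (i j : Fin 3) : Fin 3 := -(i + j)

theorem third_ne : ∀ i j : Fin 3, i ≠ j → third i j ≠ i ∧ third i j ≠ j := by
  decide

/-- The (co-)metric in the coordinates `(z_p, conj z_p)`: the matrix of all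
`Γ(z_i, z_j)`, `Γ(z_i, conj z_j)`, `Γ(conj z_i, z_j)`, `Γ(conj z_i, conj z_j)`. -/
def metric (z : C3) : Matrix Idx Idx ℂ := fun a b =>
  match a, b with
  | Sum.inl i, Sum.inl j =>
      if i = j then -(z i) ^ 2 else (3 / 2 : ℂ) * conj (z (third i j)) - z i * z j
  | Sum.inr i, Sum.inr j =>
      if i = j then -(conj (z i)) ^ 2
      else (3 / 2 : ℂ) * z (third i j) - conj (z i) * conj (z j)
  | Sum.inl i, Sum.inr j =>
      (3 / 2 : ℂ) * (if i = j then 1 else 0) - (1 / 2 : ℂ) * (z i * conj (z j))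
  | Sum.inr i, Sum.inl j =>
      (3 / 2 : ℂ) * (if i = j then 1 else 0) - (1 / 2 : ℂ) * (z j * conj (z i))

/-- The carré du champ, `ℂ`-bilinear in `(f, g)`. -/
def Gam (f g : C3 → ℂ) (z : C3) : ℂ :=
  ∑ a : Idx, ∑ b : Idx, metric z a b * (wirtinger a f z * wirtinger b g z)

/-- The second-order operator with second-order part `metric` and with
`L z_p = -lam z_p`, `L (conj z_p) = -lam (conj z_p)`. -/
def Lhat (lam : ℝ) (f : C3 → ℂ) (z : C3) : ℂ :=
  (∑ a : Idx, ∑ b : Idx, metric z a b * wirtinger a (wirtinger b f) z)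
    + ∑ a : Idx, (-(lam : ℂ) * coord a z) * wirtinger a f z

/-- The connected component containing the origin of the set where the determinant of the
metric does not vanish. -/
def Omega1 : Set C3 := connectedComponentIn {z : C3 | (metric z).det ≠ 0} 0

/-- `S₁ = r₁² + r₂² + r₃²`, where `r_j = |z_j|`. -/
def S1 (z : C3) : ℝ := ∑ j : Fin 3, ‖z j‖ ^ 2

/-- `S₂ = r₁⁴ + r₂⁴ + r₃⁴`. -/
def S2 (z : C3) : ℝ := ∑ j : Fin 3, ‖z j‖ ^ 4

/-- `σ = r₁ r₂ r₃ cos (θ₁ + θ₂ + θ₃) = Re (z₁ z₂ z₃)`, where `z_j = r_j exp (i θ_j)`. -/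
def sig (z : C3) : ℝ := (z 0 * z 1 * z 2).re

/-- The polynomial `P₁`. -/
def P1 (z : C3) : ℝ := 2 - (S1 z + 1) ^ 2 + 2 * S2 z + 8 * sig z

/-- The normalizing constant `C_β`. -/
def normConst (β : ℝ) : ℝ := (∫ z in Omega1, P1 z ^ β)⁻¹

/-- The measure `C_β P₁^β dx` on `Omega1`. -/
def mu (β : ℝ) : Measure C3 :=
  (volume.restrict Omega1).withDensity fun z => ENNReal.ofReal (normConst β * P1 z ^ β)

/-- Test functions: complex-valued functions that are smooth (in the real sense) on a
neighborhood of the closure of `Omega1`. No boundary condition is imposed. -/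
def IsTestFunction (f : C3 → ℂ) : Prop :=
  ∃ U : Set C3, IsOpen U ∧ closure Omega1 ⊆ U ∧ ContDiffOn ℝ ∞ f U

/-- `L` is reversible (symmetric) with respect to `μ`, with carré du champ `Γ`:
`∫ f (L g) dμ = ∫ (L f) g dμ = -∫ Γ(f, g) dμ` for all test functions `f`, `g`, where all the
integrals converge absolutely. -/
def IsReversible (L : (C3 → ℂ) → C3 → ℂ) (Γ : (C3 → ℂ) → (C3 → ℂ) → C3 → ℂ)
    (μ : Measure C3) : Prop :=
  ∀ f g : C3 → ℂ, IsTestFunction f → IsTestFunction g →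
    Integrable (fun z => f z * L g z) μ ∧
    Integrable (fun z => L f z * g z) μ ∧
    Integrable (fun z => Γ f g z) μ ∧
    ∫ z, f z * L g z ∂μ = ∫ z, L f z * g z ∂μ ∧
    ∫ z, f z * L g z ∂μ = -∫ z, Γ f g z ∂μ

end DeltoidModel

end

noncomputable section

namespace DeltoidModel

/-! The determinant of the metric is a constant times `P1` times a second factor, `detCofactor`. The
explicit bounded set `region` has the property that every point of its closure with `P1 ≠ 0` lies in
it, so the connected set `Omega1` cannot leave it. This gives `0 < P1` and boundedness. On `region`
the second factor is negative, so `P1` vanishes at every boundary point of `Omega1`.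

Integrability for negative `β` comes from `P1 = E² - 4‖v‖²`, where `v = conj z₂ - z₀ z₁` and `E = 1
+ ‖z₂‖² - ‖z₀‖² - ‖z₁‖²`. In polar coordinates `v = r u`, `radial_bound` gives `P1 ≥ s q r`, where
`s` is a constant minus `r` and `q = ‖z₀ - u conj z₁‖²`. The Jacobian `r` leaves `r ^ (1 + β) s ^ β
q ^ β`: its first factor is bounded, `s ^ β` is integrable in `r`, and `q ^ β` is integrable in
`z₁`, all because `β > -1`.

Reversibility rests on two identities: `Γ(u_a, P1) = -3 u_a P1` (`sum_metric_gradP1`) and `∑_a ∂_a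
Γ(u_a, u_b) = -(11/2) u_b` (`sum_wirtinger_metric`). Hence the divergence of `P1 ^ β f Γ(·, g)` is
`P1 ^ β (Γ(f, g) + f L g)` with `lam = 11/2 + 3β`. The first identity also removes the boundary
term: a cutoff `χ(N P1)` contributes only `N P1 χ'(N P1)`, which is bounded uniformly in `N` and
tends to `0` pointwise, so dominated convergence applies for every `β > -1` without boundary
conditions. -/

/-! ### Factorization of the determinant -/

/-- Here `u, v, w` replace the conjugates of `a, b, c`; the factorization holds with all six
variables independent. -/
theorem det_metric_poly (a b c u v w : ℂ) :
    (!![-a^2, 3/2*w - a*b, 3/2*v-a*c, 3/2-1/2*(a*u), -(1/2)*(a*v), -(1/2)*(a*w);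
       3/2*w - a*b, -b^2, 3/2*u-b*c, -(1/2)*(b*u), 3/2-(1/2)*(b*v), -(1/2)*(b*w);
       3/2*v - a*c, 3/2*u-b*c, -c^2, -(1/2)*(c*u), -(1/2)*(c*v), 3/2-(1/2)*(c*w);
       3/2-1/2*(a*u), -(1/2)*(b*u), -(1/2)*(c*u), -u^2, 3/2*c - u*v, 3/2*b-u*w;
       -(1/2)*(a*v), 3/2-1/2*(b*v), -(1/2)*(c*v), 3/2*c - u*v, -v^2, 3/2*a-v*w;
       -(1/2)*(a*w), -(1/2)*(b*w), 3/2-1/2*(c*w), 3/2*b - u*w, 3/2*a-v*w, -w^2] : Matrix (Fin 6) (Fin 6) ℂ).det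
    = 243/64 * (2 - (a*u+b*v+c*w+1)^2 + 2*((a*u)^2+(b*v)^2+(c*w)^2) + 4*(a*b*c+u*v*w)) *
      ((1+c*w-a*u-b*v)^2 - 4*(1-a*u)*(1-b*v)) := by
  simp [Matrix.det_succ_row_zero, Fin.sum_univ_succ, Fin.succAbove]
  ring

theorem det_metric_aux (z : C3) : (metric z).det = 243/64 *
    (2 - (z 0*conj (z 0)+z 1*conj (z 1)+z 2*conj (z 2)+1)^2
      + 2*((z 0*conj (z 0))^2+(z 1*conj (z 1))^2+(z 2*conj (z 2))^2)
      + 4*(z 0*z 1*z 2+conj (z 0)*conj (z 1)*conj (z 2))) *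
      ((1+z 2*conj (z 2)-z 0*conj (z 0)-z 1*conj (z 1))^2
        - 4*(1-z 0*conj (z 0))*(1-z 1*conj (z 1))) := by
  have h01 : third 0 1 = 2 := rfl
  have h10 : third 1 0 = 2 := rfl
  have h02 : third 0 2 = 1 := rfl
  have h20 : third 2 0 = 1 := rfl
  have h12 : third 1 2 = 0 := rfl
  have h21 : third 2 1 = 0 := rfl
  rw [← det_metric_poly, ← Matrix.det_submatrix_equiv_self (finSumFinEquiv (m := 3) (n := 3)).symm]
  congr 1
  ext i j
  fin_cases i <;> fin_cases j <;>
    simp [metric, finSumFinEquiv, Fin.addCases, h01, h10, h02,h20,h12,h21, -one_div] 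
  all_goals ring

/-- The second factor of the determinant of the metric, up to a constant. -/
def detCofactor (z : C3) : ℝ :=
  (1 + ‖z 2‖ ^ 2 - ‖z 0‖ ^ 2 - ‖z 1‖ ^ 2) ^ 2 - 4 * (1 - ‖z 0‖ ^ 2) * (1 - ‖z 1‖ ^ 2)

theorem ofReal_P1 (z : C3) : (P1 z : ℂ) =
    2 - (z 0*conj (z 0)+z 1*conj (z 1)+z 2*conj (z 2)+1)^2
      + 2*((z 0*conj (z 0))^2+(z 1*conj (z 1))^2+(z 2*conj (z 2))^2)
      + 4*(z 0*z 1*z 2+conj (z 0)*conj (z 1)*conj (z 2)) := by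
  have h : ((sig z : ℝ) : ℂ) = (z 0*z 1*z 2+conj (z 0)*conj (z 1)*conj (z 2)) / 2 := by
    rw [sig, Complex.re_eq_add_conj]; simp
  simp only [P1, S1, S2, Fin.sum_univ_three, Complex.mul_conj']
  push_cast
  rw [h]; ring

theorem det_metric (z : C3) :
    (metric z).det = ((243 / 64 * P1 z * detCofactor z : ℝ) : ℂ) := by
  rw [det_metric_aux, ← ofReal_P1]
  simp only [detCofactor, Complex.mul_conj']
  push_cast
  ring

/-! ### Confinement of `Omega1` and its boundary -/

theorem P1_eq_two (z : C3) : P1 z = (1 + ‖z 2‖ ^ 2 - ‖z 0‖ ^ 2 - ‖z 1‖ ^ 2) ^ 2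
    - 4 * ‖conj (z 2) - z 0 * z 1‖ ^ 2 := by
  have h : ∀ w : ℂ, ‖w‖ ^ 4 = (‖w‖ ^ 2) ^ 2 := fun w => by ring
  simp only [P1, S1, S2, sig, Fin.sum_univ_three, h, Complex.sq_norm, Complex.normSq_apply,
    Complex.mul_re, Complex.mul_im, Complex.sub_re, Complex.sub_im, Complex.conj_re,
    Complex.conj_im]
  ring

theorem P1_eq_zero (z : C3) : P1 z = (1 + ‖z 0‖ ^ 2 - ‖z 1‖ ^ 2 - ‖z 2‖ ^ 2) ^ 2
    - 4 * ‖conj (z 0) - z 1 * z 2‖ ^ 2 := by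
  have h : ∀ w : ℂ, ‖w‖ ^ 4 = (‖w‖ ^ 2) ^ 2 := fun w => by ring
  simp only [P1, S1, S2, sig, Fin.sum_univ_three, h, Complex.sq_norm, Complex.normSq_apply,
    Complex.mul_re, Complex.mul_im, Complex.sub_re, Complex.sub_im, Complex.conj_re,
    Complex.conj_im]
  ring

theorem continuous_P1 : Continuous P1 := by
  unfold P1 S1 S2 sig
  fun_prop

theorem continuous_detCofactor : Continuous detCofactor := by
  unfold detCofactor
  fun_prop

theorem isOpen_det_ne_zero : IsOpen {z : C3 | (metric z).det ≠ 0} := by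
  simp only [det_metric]
  refine isOpen_ne_fun ?_ continuous_const
  exact Complex.continuous_ofReal.comp
    ((continuous_const.mul continuous_P1).mul continuous_detCofactor)

theorem isOpen_Omega1 : IsOpen Omega1 := isOpen_det_ne_zero.connectedComponentIn

theorem zero_mem_det_ne_zero : (0 : C3) ∈ {z : C3 | (metric z).det ≠ 0} := by
  simp [det_metric, P1, S1, S2, sig, detCofactor]
  norm_num

theorem zero_mem_Omega1 : (0 : C3) ∈ Omega1 := mem_connectedComponentIn zero_mem_det_ne_zero

theorem Omega1_subset_det : Omega1 ⊆ {z : C3 | (metric z).det ≠ 0} :=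
  connectedComponentIn_subset _ _

theorem continuous_norm_apply (i : Fin 3) : Continuous fun z : C3 => ‖z i‖ := by fun_prop

theorem continuous_defect :
    Continuous fun z : C3 => 1 + ‖z 2‖ ^ 2 - ‖z 0‖ ^ 2 - ‖z 1‖ ^ 2 := by fun_prop

/-- The explicit semialgebraic region that contains `Omega1`. -/
def region : Set C3 :=
  {z | ‖z 0‖ < 1 ∧ ‖z 1‖ < 1 ∧ ‖z 2‖ < 1 ∧
    0 < 1 + ‖z 2‖ ^ 2 - ‖z 0‖ ^ 2 - ‖z 1‖ ^ 2 ∧ 0 < P1 z}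

theorem isOpen_region : IsOpen region := by
  exact (isOpen_lt (continuous_norm_apply 0) continuous_const).inter
    ((isOpen_lt (continuous_norm_apply 1) continuous_const).inter
    ((isOpen_lt (continuous_norm_apply 2) continuous_const).inter
    ((isOpen_lt continuous_const continuous_defect).inter
      (isOpen_lt continuous_const continuous_P1))))

theorem closure_region_subset : closure region ⊆
    {z | ‖z 0‖ ≤ 1 ∧ ‖z 1‖ ≤ 1 ∧ ‖z 2‖ ≤ 1 ∧
      0 ≤ 1 + ‖z 2‖ ^ 2 - ‖z 0‖ ^ 2 - ‖z 1‖ ^ 2 ∧ 0 ≤ P1 z} := by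
  refine closure_minimal ?_ ?_
  · rintro z ⟨h0, h1, h2, h3, h4⟩
    exact ⟨h0.le, h1.le, h2.le, h3.le, h4.le⟩
  · exact (isClosed_le (continuous_norm_apply 0) continuous_const).inter
      ((isClosed_le (continuous_norm_apply 1) continuous_const).inter
      ((isClosed_le (continuous_norm_apply 2) continuous_const).inter
      ((isClosed_le continuous_const continuous_defect).inter
        (isClosed_le continuous_const continuous_P1))))

/-- Forces `P1 ≤ 0` on a face where one coordinate has modulus `1`: there the defect is `±(p² - q²)`
for the other two moduli, and `n` is the norm in `P1_eq_two` or `P1_eq_zero`. -/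
theorem sq_sub_sq_sq_le {p q n : ℝ} (hp : 0 ≤ p) (hq : 0 ≤ q) (hp1 : p ≤ 1) (hq1 : q ≤ 1)
    (h : |p - q| ≤ n) : (p ^ 2 - q ^ 2) ^ 2 ≤ 4 * n ^ 2 := by
  have h1 : (p - q) ^ 2 ≤ n ^ 2 := sq_le_sq' (by linarith [abs_le.1 h]) (by linarith [abs_le.1 h])
  have h2 : (p + q) ^ 2 ≤ 4 := by nlinarith
  calc (p ^ 2 - q ^ 2) ^ 2 = (p + q) ^ 2 * (p - q) ^ 2 := by ring
    _ ≤ 4 * n ^ 2 := mul_le_mul h2 h1 (sq_nonneg _) (by norm_num)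

theorem abs_norm_sub_le_of_norm_one {a b c : ℂ} (ha : ‖a‖ = 1) :
    |‖c‖ - ‖b‖| ≤ ‖conj c - a * b‖ := by
  have := abs_norm_sub_norm_le (conj c) (a * b)
  rwa [norm_mul, ha, one_mul, RCLike.norm_conj] at this

/-- If one of the other inequalities defining `region` degenerated to an equality, the
difference-of-squares form of `P1` would be nonpositive. -/
theorem mem_region_of_closure {z : C3} (hz : z ∈ closure region) (hP : P1 z ≠ 0) :
    z ∈ region := by
  obtain ⟨h0, h1, h2, hE, hP0⟩ := closure_region_subset hz
  have hP : 0 < P1 z := lt_of_le_of_ne hP0 (Ne.symm hP)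
  refine ⟨lt_of_le_of_ne h0 ?_, lt_of_le_of_ne h1 ?_, lt_of_le_of_ne h2 ?_,
    lt_of_le_of_ne hE ?_, hP⟩
  · intro h
    have := sq_sub_sq_sq_le (norm_nonneg _) (norm_nonneg _) h2 h1
      (abs_norm_sub_le_of_norm_one h)
    rw [P1_eq_two, h] at hP
    nlinarith
  · intro h
    have := sq_sub_sq_sq_le (norm_nonneg _) (norm_nonneg _) h2 h0
      (abs_norm_sub_le_of_norm_one h)
    rw [P1_eq_two, h, mul_comm (z 0)] at hP
    nlinarith
  -- The face `‖z 2‖ = 1` needs the form of `P1` that singles out another coordinate.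
  · intro h
    have := sq_sub_sq_sq_le (norm_nonneg _) (norm_nonneg _) h0 h1
      (abs_norm_sub_le_of_norm_one h)
    rw [P1_eq_zero, h, mul_comm (z 1)] at hP
    nlinarith
  · intro h
    rw [P1_eq_two, ← h] at hP
    nlinarith [sq_nonneg ‖conj (z 2) - z 0 * z 1‖]

theorem Omega1_subset_region : Omega1 ⊆ region := by
  refine isPreconnected_connectedComponentIn.subset_of_closure_inter_subset isOpen_region
    ⟨0, zero_mem_Omega1, ?_⟩ ?_
  · simp [region, P1, S1, S2, sig]
  · rintro z ⟨hz, hz'⟩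
    refine mem_region_of_closure hz fun h => Omega1_subset_det hz' ?_
    simp [det_metric, h]

theorem P1_pos {z : C3} (hz : z ∈ Omega1) : 0 < P1 z := (Omega1_subset_region hz).2.2.2.2

theorem norm_add_sq_complex (a v : ℂ) :
    ‖a + v‖ ^ 2 = ‖a‖ ^ 2 + 2 * (conj a * v).re + ‖v‖ ^ 2 := by
  simp only [Complex.sq_norm, Complex.normSq_apply, Complex.mul_re, Complex.add_re,
    Complex.add_im, Complex.conj_re, Complex.conj_im]
  ring

/-- With `s = √((1 - x)(1 - y))`, the defect is `E = s² + r² + 2T`. The bound `T ≤ r(1 - r)` gives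
`E ≤ s² - r² + 2r`, so `2r < E` forces `r < s`. AM-GM gives `T ≤ r(1 - s)`, so `E ≤ (s - r)² + 2r <
2s`. -/
theorem sq_lt_four_mul_of_region {x y w r T : ℝ} (hx : 0 ≤ x) (hx1 : x < 1) (hy : 0 ≤ y)
    (hy1 : y < 1) (hw1 : w < 1) (hr : 0 ≤ r) (hw : w = x * y + 2 * T + r ^ 2)
    (hT : T ≤ r * ((x + y) / 2)) (hE : 2 * r < 1 + w - x - y) :
    (1 + w - x - y) ^ 2 < 4 * (1 - x) * (1 - y) := by
  obtain ⟨s, hs, hs2⟩ : ∃ s : ℝ, 0 ≤ s ∧ s ^ 2 = (1 - x) * (1 - y) :=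
    ⟨_, Real.sqrt_nonneg _, Real.sq_sqrt (mul_nonneg (by linarith) (by linarith))⟩
  have hs1 : s ≤ 1 - (x + y) / 2 := by
    refine abs_le_of_sq_le_sq' ?_ (by linarith) |>.2
    nlinarith [sq_nonneg (x - y)]
  have hTs : T ≤ r * (1 - s) := hT.trans (mul_le_mul_of_nonneg_left (by linarith) hr)
  have hTr : T ≤ r * (1 - r) := hT.trans (mul_le_mul_of_nonneg_left (by linarith) hr)
  have hE' : 1 + w - x - y = s ^ 2 + r ^ 2 + 2 * T := by rw [hs2, hw]; ring
  have hrs : r < s := by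
    by_contra! h
    nlinarith
  have h2 : 1 + w - x - y < 2 * s := by nlinarith
  nlinarith

theorem re_conj_mul_le (a b v : ℂ) :
    (conj (a * b) * v).re ≤ ‖v‖ * ((‖a‖ ^ 2 + ‖b‖ ^ 2) / 2) := by
  refine (Complex.re_le_norm _).trans ?_
  rw [norm_mul, RCLike.norm_conj, norm_mul, mul_comm]
  exact mul_le_mul_of_nonneg_left (by nlinarith [sq_nonneg (‖a‖ - ‖b‖)]) (norm_nonneg _)

theorem two_norm_lt_of_region {z : C3} (hz : z ∈ region) :
    2 * ‖conj (z 2) - z 0 * z 1‖ < 1 + ‖z 2‖ ^ 2 - ‖z 0‖ ^ 2 - ‖z 1‖ ^ 2 := by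
  obtain ⟨h0, h1, h2, hE, hP⟩ := hz
  rw [P1_eq_two] at hP
  refine abs_lt_of_sq_lt_sq' ?_ hE.le |>.2
  nlinarith

theorem detCofactor_neg {z : C3} (hz : z ∈ region) : detCofactor z < 0 := by
  have hE := two_norm_lt_of_region hz
  obtain ⟨h0, h1, h2, -, hP⟩ := hz
  have h := sq_lt_four_mul_of_region (sq_nonneg ‖z 0‖)
    (by nlinarith [norm_nonneg (z 0)]) (sq_nonneg ‖z 1‖) (by nlinarith [norm_nonneg (z 1)])
    (by nlinarith [norm_nonneg (z 2)] : ‖z 2‖ ^ 2 < 1)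
    (norm_nonneg (conj (z 2) - z 0 * z 1)) ?_ (re_conj_mul_le (z 0) (z 1) _) hE
  · unfold detCofactor
    linarith
  · have := norm_add_sq_complex (z 0 * z 1) (conj (z 2) - z 0 * z 1)
    rw [add_sub_cancel, RCLike.norm_conj, norm_mul, mul_pow] at this
    exact this

/-- Otherwise `z` lies in `region`, both factors of the determinant are nonzero there, and adjoining
`z` to the component keeps it connected, against maximality. -/
theorem P1_eq_zero_of_mem_closure {z : C3} (hz : z ∈ closure Omega1) (hz' : z ∉ Omega1) :
    P1 z = 0 := by
  by_contra hP
  have hW := mem_region_of_closure (closure_mono Omega1_subset_region hz) hP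
  refine hz' ?_
  have hc : IsPreconnected (insert z Omega1) :=
    isPreconnected_connectedComponentIn.subset_closure (Set.subset_insert _ _)
      (Set.insert_subset hz subset_closure)
  refine hc.subset_connectedComponentIn (Set.mem_insert_of_mem _ zero_mem_Omega1) ?_
    (Set.mem_insert _ _)
  refine Set.insert_subset ?_ Omega1_subset_det
  simp only [Set.mem_ofPred_eq, det_metric, ne_eq, Complex.ofReal_eq_zero]
  exact mul_ne_zero (mul_ne_zero (by norm_num) hP) (detCofactor_neg hW).ne

theorem Omega1_subset_ball : Omega1 ⊆ Metric.closedBall 0 1 := by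
  intro z hz
  obtain ⟨h0, h1, h2, -⟩ := Omega1_subset_region hz
  rw [mem_closedBall_zero_iff, pi_norm_le_iff_of_nonneg zero_le_one]
  intro i
  fin_cases i
  exacts [h0.le, h1.le, h2.le]

theorem isCompact_closure_Omega1 : IsCompact (closure Omega1) :=
  (Metric.isBounded_closedBall.subset Omega1_subset_ball).isCompact_closure

/-! ### Integrability of `P1 ^ β` -/

theorem lintegral_C3 (f : C3 → ENNReal) (hf : Measurable f) :
    ∫⁻ z, f z = ∫⁻ a : ℂ, ∫⁻ b : ℂ, ∫⁻ c : ℂ, f ![a, b, c] := by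
  have h1 := (volume_preserving_piFinSuccAbove (fun _ : Fin 3 => ℂ) 0).symm
  rw [← h1.lintegral_comp hf, Measure.volume_eq_prod, lintegral_prod _ (by fun_prop)]
  refine lintegral_congr fun a => ?_
  have h2 := (volume_preserving_finTwoArrow ℂ).symm
  have hm : Measurable fun y : Fin 2 → ℂ =>
      f ((MeasurableEquiv.piFinSuccAbove (fun _ : Fin 3 => ℂ) 0).symm (a, y)) := by fun_prop
  rw [← h2.lintegral_comp hm, Measure.volume_eq_prod, lintegral_prod _ (by fun_prop)]
  refine lintegral_congr fun b => lintegral_congr fun c => ?_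
  congr 1
  ext i
  fin_cases i <;> rfl

/-- With `a = z₀ z₁` this makes `v = conj z₂ - z₀ z₁` the integration variable. -/
theorem lintegral_conj_add (f : ℂ → ENNReal) (a : ℂ) :
    ∫⁻ c, f c = ∫⁻ v, f (conj (a + v)) := by
  have h := Complex.conjLIE.measurePreserving.lintegral_comp_emb
    Complex.conjLIE.toMeasurableEquiv.measurableEmbedding f
  rw [← h, ← lintegral_add_left_eq_self _ a]
  rfl

theorem lintegral_sub_mul_conj (f : ℂ → ENNReal) (a : ℂ) {u : ℂ} (hu : ‖u‖ = 1) :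
    ∫⁻ b, f (a - u * conj b) = ∫⁻ w, f w := by
  have h := Complex.conjLIE.measurePreserving.lintegral_comp_emb
    Complex.conjLIE.toMeasurableEquiv.measurableEmbedding (fun b => f (a - u * b))
  let R : ℂ ≃ₗᵢ[ℝ] ℂ := rotation ⟨u, by simp [Submonoid.unitSphere, hu]⟩
  have h' := R.measurePreserving.lintegral_comp_emb
    R.toMeasurableEquiv.measurableEmbedding (fun b => f (a - b))
  calc ∫⁻ b, f (a - u * conj b) = ∫⁻ b, f (a - u * b) := h
    _ = ∫⁻ b, f (a - b) := h'
    _ = _ := lintegral_sub_left_eq_self f a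

theorem lintegral_polar (f : ℂ → ENNReal) (hf : Measurable f) :
    ∫⁻ v, f v = ∫⁻ t in Set.Ioo (-Real.pi) Real.pi, ∫⁻ r in Set.Ioi (0 : ℝ),
      ENNReal.ofReal r * f (r * Complex.exp (t * Complex.I)) := by
  rw [← Complex.lintegral_comp_polarCoord_symm]
  simp only [Complex.polarCoord_symm_apply, smul_eq_mul]
  rw [show polarCoord.target = Set.Ioi (0 : ℝ) ×ˢ Set.Ioo (-Real.pi) Real.pi from rfl,
    Measure.volume_eq_prod, ← Measure.prod_restrict, lintegral_prod_symm' _ (by fun_prop)]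
  simp only [Complex.exp_mul_I, Complex.ofReal_cos, Complex.ofReal_sin]

theorem lintegral_Ioo_rpow_lt_top {β b : ℝ} (hβ : -1 < β) (hb : 0 < b) :
    ∫⁻ s, (Set.Ioo (0 : ℝ) b).indicator (fun s => ENNReal.ofReal (s ^ β)) s < ⊤ := by
  rw [lintegral_indicator measurableSet_Ioo]
  exact Integrable.lintegral_lt_top ((intervalIntegral.integrableOn_Ioo_rpow_iff hb).2 hβ)

/-- The kernel `‖w‖ ^ (2 β)`, cut off at radius `3`. -/
def cutoffKernel (β : ℝ) : ℂ → ENNReal :=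
  (Metric.ball (0 : ℂ) 3).indicator fun w => ENNReal.ofReal (‖w‖ ^ 2) ^ β

theorem measurable_cutoffKernel (β : ℝ) : Measurable (cutoffKernel β) := by
  unfold cutoffKernel
  refine Measurable.indicator ?_ Metric.isOpen_ball.measurableSet
  fun_prop

theorem lintegral_cutoffKernel_lt_top {β : ℝ} (hβ : -1 < β) :
    ∫⁻ w, cutoffKernel β w < ⊤ := by
  have hA : ∫⁻ s, (Set.Ioo (0 : ℝ) 3).indicator (fun s => ENNReal.ofReal (s ^ (1 + 2 * β))) s < ⊤ :=
    lintegral_Ioo_rpow_lt_top (by linarith) (by norm_num)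
  rw [lintegral_polar _ (measurable_cutoffKernel β)]
  calc _ ≤ ∫⁻ t in Set.Ioo (-Real.pi) Real.pi, ∫⁻ s,
        (Set.Ioo (0 : ℝ) 3).indicator (fun s => ENNReal.ofReal (s ^ (1 + 2 * β))) s := by
        refine lintegral_mono fun t => ?_
        rw [← lintegral_indicator measurableSet_Ioi]
        refine lintegral_mono fun r => ?_
        by_cases hr : 0 < r
        swap; · simp [hr]
        have hn : ‖(r : ℂ) * Complex.exp (t * Complex.I)‖ = r := by
          simp [Complex.norm_exp_ofReal_mul_I, abs_of_pos hr]
        by_cases hr3 : r < 3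
        swap
        · have hb : (r : ℂ) * Complex.exp (t * Complex.I) ∉ Metric.ball (0 : ℂ) 3 := by
            rwa [mem_ball_zero_iff, hn]
          rw [Set.indicator_of_mem (Set.mem_Ioi.2 hr), cutoffKernel, Set.indicator_of_notMem hb,
            mul_zero]
          exact zero_le
        simp only [cutoffKernel, Set.mem_Ioi, hr, Set.indicator_of_mem, Metric.mem_ball,
          dist_zero_right, hn, hr3, Set.mem_Ioo, and_self]
        rw [ENNReal.ofReal_rpow_of_pos (by positivity), ← ENNReal.ofReal_mul hr.le,
          Real.rpow_add hr, Real.rpow_one, Real.rpow_mul hr.le, Real.rpow_two]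
    _ < ⊤ := by
        rw [setLIntegral_const]
        exact ENNReal.mul_lt_top hA (by simp)

/-- As a quadratic in `r`, `E - 2r = (c - r)² - k²` with `k² = c² - (1 - x)(1 - y) ≥ q²/4`. Its
factor `c - r + k` is at least `2k ≥ q`, and `E + 2r ≥ r`; the remaining factor `c - k - r` is kept.
-/
theorem radial_bound {x y w r c q : ℝ} (hx : 0 ≤ x) (hx1 : x < 1) (hy : 0 ≤ y) (hy1 : y < 1)
    (hw1 : w < 1) (hr : 0 < r) (hq : 0 ≤ q) (hc : c = 1 - (x + y) / 2 + q / 2)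
    (hw : w = x * y + 2 * (r * (1 - c)) + r ^ 2) (hE : 2 * r < 1 + w - x - y) :
    r < 1 ∧ c - √(c ^ 2 - (1 - x) * (1 - y)) - r ∈ Set.Ioo 0 1 ∧
      (c - √(c ^ 2 - (1 - x) * (1 - y)) - r) * q * r ≤ (1 + w - x - y) ^ 2 - 4 * r ^ 2 := by
  have hm : (1 - x) * (1 - y) ≤ (1 - (x + y) / 2) ^ 2 := by nlinarith [sq_nonneg (x - y)]
  have hm0 : 0 < 1 - (x + y) / 2 := by linarith
  have hcd : q ^ 2 / 4 ≤ c ^ 2 - (1 - x) * (1 - y) := by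
    rw [hc]; nlinarith
  have hd0 : 0 < (1 - x) * (1 - y) := mul_pos (by linarith) (by linarith)
  have hd1 : (1 - x) * (1 - y) ≤ 1 := by nlinarith
  obtain ⟨k, hk⟩ : ∃ k, k = √(c ^ 2 - (1 - x) * (1 - y)) := ⟨_, rfl⟩
  have hk0 : 0 ≤ k := hk ▸ Real.sqrt_nonneg _
  have hk2 : k ^ 2 = c ^ 2 - (1 - x) * (1 - y) := by
    rw [hk, Real.sq_sqrt]; nlinarith [sq_nonneg q]
  rw [← hk]
  have hrc : r < c := by linarith
  have hF : 1 + w - x - y - 2 * r = (c - r - k) * (c - r + k) := by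
    rw [hw]; linear_combination hk2
  have hkq : q / 2 ≤ k := abs_le_of_sq_le_sq' (by rw [hk2]; linarith) hk0 |>.2
  have hs : 0 < c - r - k := by
    by_contra! h
    nlinarith
  -- The product `(c - k)(c + k) = (1 - x)(1 - y)` is at most `1`, and `c - k` is the smaller
  -- factor.
  have hck : c - k ≤ 1 := by
    by_contra! h
    nlinarith
  refine ⟨by linarith, ⟨by linarith, by linarith⟩, ?_⟩
  have h1 : (c - k - r) * q ≤ 1 + w - x - y - 2 * r := by
    rw [hF, show c - k - r = c - r - k by ring]
    exact mul_le_mul_of_nonneg_left (by linarith) hs.le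
  have h2 : r ≤ 1 + w - x - y + 2 * r := by linarith
  calc (c - k - r) * q * r ≤ (1 + w - x - y - 2 * r) * (1 + w - x - y + 2 * r) :=
        mul_le_mul h1 h2 hr.le (by linarith)
    _ = _ := by ring

/-- The indicator of `region` times `P1 ^ β`. -/
def regionPow (β : ℝ) : C3 → ENNReal := region.indicator fun z => ENNReal.ofReal (P1 z ^ β)

theorem measurable_regionPow (β : ℝ) : Measurable (regionPow β) := by
  have := continuous_P1.measurable
  unfold regionPow
  exact Measurable.indicator (by fun_prop) isOpen_region.measurableSet

/-- Since `ρ` does not depend on `r`, integrating the right side in `r` gives a bound uniform in `a,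
b, u` for the first factor. The second factor depends on `b` only through an isometric image of it.
-/
theorem mul_regionPow_le {β : ℝ} (hβ : -1 < β) (hβ0 : β < 0) (a b u : ℂ) (hu : ‖u‖ = 1) :
    ∃ ρ : ℝ, ∀ r : ℝ, 0 < r →
      ENNReal.ofReal r * regionPow β ![a, b, conj (a * b + r * u)] ≤
        (Set.Ioo (0 : ℝ) 1).indicator (fun s => ENNReal.ofReal (s ^ β)) (ρ - r) *
          ((Metric.ball (0 : ℂ) 1).indicator 1 a * cutoffKernel β (a - u * conj b)) := by
  obtain ⟨c, hc⟩ : ∃ c, c = 1 - (‖a‖ ^ 2 + ‖b‖ ^ 2) / 2 + ‖a - u * conj b‖ ^ 2 / 2 := ⟨_, rfl⟩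
  refine ⟨c - √(c ^ 2 - (1 - ‖a‖ ^ 2) * (1 - ‖b‖ ^ 2)), fun r hr => ?_⟩
  by_cases hz : ![a, b, conj (a * b + r * u)] ∈ region
  swap
  · rw [regionPow, Set.indicator_of_notMem hz, mul_zero]
    exact zero_le
  have hE := two_norm_lt_of_region hz
  have hP := P1_eq_two ![a, b, conj (a * b + r * u)]
  have h4 : 0 < P1 ![a, b, conj (a * b + r * u)] := hz.2.2.2.2
  obtain ⟨h0, h1, h2, -⟩ := id hz
  simp only [Matrix.cons_val_zero, Matrix.cons_val_one, Matrix.cons_val, RCLike.norm_conj,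
    RingHomCompTriple.comp_apply, RingHom.id_apply, add_sub_cancel_left, norm_mul, hu, mul_one,
    Complex.norm_real, Real.norm_eq_abs, abs_of_pos hr] at hE hP h0 h1 h2
  have hw : ‖a * b + r * u‖ ^ 2 = ‖a‖ ^ 2 * ‖b‖ ^ 2 + 2 * (r * (1 - c)) + r ^ 2 := by
    have hu2 : u.re ^ 2 + u.im ^ 2 = 1 := by
      have := Complex.sq_norm u
      rw [hu, Complex.normSq_apply] at this
      linarith
    rw [hc]
    simp only [Complex.sq_norm, Complex.normSq_apply, Complex.mul_re, Complex.mul_im,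
      Complex.sub_re, Complex.sub_im, Complex.add_re, Complex.add_im, Complex.conj_re,
      Complex.conj_im, Complex.ofReal_re, Complex.ofReal_im]
    linear_combination (r ^ 2 + r * (b.re ^ 2 + b.im ^ 2)) * hu2
  obtain ⟨hr1, hs, hle⟩ := radial_bound (sq_nonneg ‖a‖) (by nlinarith [norm_nonneg a])
    (sq_nonneg ‖b‖) (by nlinarith [norm_nonneg b])
    (by nlinarith [norm_nonneg (a * b + r * u)]) hr (sq_nonneg _) hc hw hE
  rw [← hP] at hle
  set s := c - √(c ^ 2 - (1 - ‖a‖ ^ 2) * (1 - ‖b‖ ^ 2)) - r with hs_def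
  have hq3 : ‖a - u * conj b‖ < 3 := by
    refine (norm_sub_le _ _).trans_lt ?_
    rw [norm_mul, hu, RCLike.norm_conj]
    linarith
  simp only [regionPow, Set.indicator_of_mem hz, Set.indicator_of_mem hs, cutoffKernel,
    Metric.mem_ball, dist_zero_right, h0, hq3, Set.indicator_of_mem, Pi.one_apply, one_mul]
  -- At `q = 0` the kernel is `⊤`, because extended powers with `β < 0` send `0` to `⊤`; the bound
  -- is then trivial.
  rcases (norm_nonneg (a - u * conj b)).eq_or_lt with hq | hq
  · rw [← hq]
    simp only [ne_eq, OfNat.ofNat_ne_zero, not_false_eq_true, zero_pow, ENNReal.ofReal_zero,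
      ENNReal.zero_rpow_of_neg hβ0]
    rw [ENNReal.mul_top]
    · exact le_top
    · simp [Real.rpow_pos_of_pos hs.1]
  · rw [ENNReal.ofReal_rpow_of_pos (by positivity), ← ENNReal.ofReal_mul hr.le,
      ← ENNReal.ofReal_mul (Real.rpow_nonneg hs.1.le _)]
    refine ENNReal.ofReal_le_ofReal ?_
    have hs0 := hs.1
    calc r * P1 ![a, b, conj (a * b + r * u)] ^ β
        ≤ r * (s * ‖a - u * conj b‖ ^ 2 * r) ^ β := by
          refine mul_le_mul_of_nonneg_left ?_ hr.le
          exact Real.rpow_le_rpow_of_nonpos (by positivity) hle hβ0.le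
      _ = r ^ (1 + β) * (s ^ β * (‖a - u * conj b‖ ^ 2) ^ β) := by
          rw [Real.mul_rpow (by positivity) hr.le, Real.mul_rpow hs0.le (by positivity),
            Real.rpow_add hr, Real.rpow_one]
          ring
      _ ≤ 1 * (s ^ β * (‖a - u * conj b‖ ^ 2) ^ β) := by
          refine mul_le_mul_of_nonneg_right ?_ (by positivity)
          exact Real.rpow_le_one hr.le hr1.le (by linarith)
      _ = _ := one_mul _

theorem lintegral_regionPow_lt_top {β : ℝ} (hβ : -1 < β) (hβ0 : β < 0) :
    ∫⁻ z, regionPow β z < ⊤ := by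
  set A := ∫⁻ s, (Set.Ioo (0 : ℝ) 1).indicator (fun s => ENNReal.ofReal (s ^ β)) s with hA
  set K := ∫⁻ w, cutoffKernel β w with hK
  have hm := measurable_regionPow β
  have hk := measurable_cutoffKernel β
  have hv : ∀ a b : ℂ, ∫⁻ c, regionPow β ![a, b, c] ≤
      ∫⁻ t in Set.Ioo (-Real.pi) Real.pi, A * ((Metric.ball (0 : ℂ) 1).indicator 1 a *
        cutoffKernel β (a - Complex.exp (t * Complex.I) * conj b)) := by
    intro a b
    have hc : Continuous fun v : ℂ => (![a, b, conj (a * b + v)] : C3) := by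
      refine continuous_pi fun i => ?_
      fin_cases i
      · exact continuous_const
      · exact continuous_const
      · change Continuous fun v : ℂ => conj (a * b + v)
        fun_prop
    rw [lintegral_conj_add _ (a * b),
      lintegral_polar (fun v => regionPow β ![a, b, conj (a * b + v)]) (hm.comp hc.measurable)]
    refine lintegral_mono fun t => ?_
    obtain ⟨ρ, hρ⟩ := mul_regionPow_le hβ hβ0 a b (Complex.exp (t * Complex.I))
      (Complex.norm_exp_ofReal_mul_I t)
    calc _ ≤ ∫⁻ r in Set.Ioi (0 : ℝ),
          (Set.Ioo (0 : ℝ) 1).indicator (fun s => ENNReal.ofReal (s ^ β)) (ρ - r) *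
          ((Metric.ball (0 : ℂ) 1).indicator 1 a *
            cutoffKernel β (a - Complex.exp (t * Complex.I) * conj b)) :=
          setLIntegral_mono' measurableSet_Ioi fun r hr => hρ r hr
      _ ≤ ∫⁻ r, (Set.Ioo (0 : ℝ) 1).indicator (fun s => ENNReal.ofReal (s ^ β)) (ρ - r) *
          ((Metric.ball (0 : ℂ) 1).indicator 1 a *
            cutoffKernel β (a - Complex.exp (t * Complex.I) * conj b)) :=
          setLIntegral_le_lintegral _ _
      _ = _ := by
          rw [lintegral_mul_const, hA, lintegral_sub_left_eq_self
            ((Set.Ioo (0 : ℝ) 1).indicator (fun s => ENNReal.ofReal (s ^ β))) ρ]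
          exact (Measurable.indicator (by fun_prop) measurableSet_Ioo).comp (by fun_prop)
  have hb : ∀ a : ℂ, ∫⁻ b, ∫⁻ c, regionPow β ![a, b, c] ≤
      (Metric.ball (0 : ℂ) 1).indicator 1 a *
        (A * K * volume (Set.Ioo (-Real.pi) Real.pi)) := by
    intro a
    have hkm : Measurable (Function.uncurry fun (b : ℂ) (t : ℝ) =>
        cutoffKernel β (a - Complex.exp (t * Complex.I) * conj b)) := by
      refine hk.comp (Continuous.measurable ?_)
      fun_prop
    refine (lintegral_mono (hv a)).trans ?_
    -- For fixed angle, `b ↦ a - u conj b` preserves Lebesgue measure, so `b` must be integrated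
    -- before the angle.
    rw [lintegral_lintegral_swap (((hkm.const_mul _).const_mul _).aemeasurable)]
    refine le_of_eq ?_
    have : ∀ t : ℝ, ∫⁻ b : ℂ, A * ((Metric.ball (0 : ℂ) 1).indicator 1 a *
        cutoffKernel β (a - Complex.exp (t * Complex.I) * conj b)) =
        A * ((Metric.ball (0 : ℂ) 1).indicator 1 a * K) := by
      intro t
      have hkt : Measurable fun b : ℂ =>
          cutoffKernel β (a - Complex.exp (t * Complex.I) * conj b) :=
        hk.comp (Continuous.measurable (by fun_prop))
      rw [lintegral_const_mul _ (hkt.const_mul _), lintegral_const_mul _ hkt,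
        lintegral_sub_mul_conj _ _ (Complex.norm_exp_ofReal_mul_I t)]
    simp only [this, setLIntegral_const]
    ring
  rw [lintegral_C3 _ hm]
  refine (lintegral_mono hb).trans_lt ?_
  rw [lintegral_mul_const _ (measurable_one.indicator Metric.isOpen_ball.measurableSet),
    lintegral_indicator_one Metric.isOpen_ball.measurableSet]
  refine ENNReal.mul_lt_top measure_ball_lt_top (ENNReal.mul_lt_top (ENNReal.mul_lt_top ?_ ?_) ?_)
  · exact lintegral_Ioo_rpow_lt_top hβ one_pos
  · exact lintegral_cutoffKernel_lt_top hβ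
  · simp

theorem integrableOn_P1_rpow {β : ℝ} (hβ : -1 < β) :
    IntegrableOn (fun z => P1 z ^ β) Omega1 volume := by
  have hmeas : Measurable fun z => P1 z ^ β := continuous_P1.measurable.pow_const β
  rcases lt_or_ge β 0 with hβ0 | hβ0
  · refine ⟨hmeas.aestronglyMeasurable, ?_⟩
    rw [hasFiniteIntegral_iff_ofReal ((ae_restrict_iff' isOpen_Omega1.measurableSet).2
      (Filter.Eventually.of_forall fun z hz => Real.rpow_nonneg (P1_pos hz).le _))]
    refine lt_of_le_of_lt ?_ (lintegral_regionPow_lt_top hβ hβ0)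
    rw [← lintegral_indicator isOpen_Omega1.measurableSet]
    refine lintegral_mono fun z => ?_
    exact Set.indicator_le_indicator_of_subset Omega1_subset_region (fun _ => zero_le) z
  · exact ((continuous_P1.rpow_const fun _ => Or.inr hβ0).continuousOn.integrableOn_compact
      isCompact_closure_Omega1).mono_set subset_closure

/-! ### Wirtinger calculus -/

/-- `f` is real differentiable at `z`, with Wirtinger derivatives `d`. -/
def HasWirt (f : C3 → ℂ) (d : Idx → ℂ) (z : C3) : Prop :=
  DifferentiableAt ℝ f z ∧ ∀ a, wirtinger a f z = d a

theorem DifferentiableAt.hasWirt {f : C3 → ℂ} {z : C3} (hf : DifferentiableAt ℝ f z) :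
    HasWirt f (fun a => wirtinger a f z) z := ⟨hf, fun _ => rfl⟩

theorem HasWirt.congr_deriv {f : C3 → ℂ} {d e : Idx → ℂ} {z : C3} (hf : HasWirt f d z)
    (h : ∀ a, d a = e a) : HasWirt f e z := ⟨hf.1, fun a => (hf.2 a).trans (h a)⟩

theorem wirtinger_congr {f g : C3 → ℂ} {z : C3} (h : f =ᶠ[nhds z] g) (a : Idx) :
    wirtinger a f z = wirtinger a g z := by
  cases a <;> simp only [wirtinger, h.fderiv_eq]

theorem hasWirt_const (c : ℂ) (z : C3) : HasWirt (fun _ => c) (fun _ => 0) z := by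
  refine ⟨by fun_prop, fun a => ?_⟩
  cases a <;> simp [wirtinger]

theorem HasWirt.add {f g : C3 → ℂ} {d e : Idx → ℂ} {z : C3} (hf : HasWirt f d z)
    (hg : HasWirt g e z) : HasWirt (fun z => f z + g z) (fun a => d a + e a) z := by
  refine ⟨hf.1.add hg.1, fun a => ?_⟩
  beta_reduce
  rw [← hf.2, ← hg.2]
  cases a <;> simp only [wirtinger, fderiv_fun_add hf.1 hg.1, add_apply] <;> ring

theorem HasWirt.mul {f g : C3 → ℂ} {d e : Idx → ℂ} {z : C3} (hf : HasWirt f d z)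
    (hg : HasWirt g e z) :
    HasWirt (fun z => f z * g z) (fun a => d a * g z + f z * e a) z := by
  refine ⟨hf.1.mul hg.1, fun a => ?_⟩
  beta_reduce
  rw [← hf.2, ← hg.2]
  cases a <;> simp only [wirtinger, fderiv_fun_mul hf.1 hg.1, add_apply,
    smul_apply, smul_eq_mul] <;> ring

theorem HasWirt.const_mul {f : C3 → ℂ} {d : Idx → ℂ} {z : C3} (c : ℂ) (hf : HasWirt f d z) :
    HasWirt (fun z => c * f z) (fun a => c * d a) z :=
  ((hasWirt_const c z).mul hf).congr_deriv fun a => by ring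

theorem HasWirt.neg {f : C3 → ℂ} {d : Idx → ℂ} {z : C3} (hf : HasWirt f d z) :
    HasWirt (fun z => -f z) (fun a => -d a) z := by
  simpa using hf.const_mul (-1)

theorem HasWirt.sub {f g : C3 → ℂ} {d e : Idx → ℂ} {z : C3} (hf : HasWirt f d z)
    (hg : HasWirt g e z) : HasWirt (fun z => f z - g z) (fun a => d a - e a) z := by
  simpa [sub_eq_add_neg] using hf.add hg.neg

theorem HasWirt.sq {f : C3 → ℂ} {d : Idx → ℂ} {z : C3} (hf : HasWirt f d z) :
    HasWirt (fun z => f z ^ 2) (fun a => 2 * f z * d a) z := by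
  simp only [pow_two]
  exact (hf.mul hf).congr_deriv fun a => by ring

theorem HasWirt.sum {ι : Type*} (s : Finset ι) {f : ι → C3 → ℂ} {d : ι → Idx → ℂ} {z : C3}
    (hf : ∀ i ∈ s, HasWirt (f i) (d i) z) :
    HasWirt (fun z => ∑ i ∈ s, f i z) (fun a => ∑ i ∈ s, d i a) z := by
  classical
  induction s using Finset.induction_on with
  | empty => simpa using hasWirt_const 0 z
  | insert i s his ih =>
    simp only [Finset.sum_insert his]
    exact (hf i (Finset.mem_insert_self _ _)).add
      (ih fun j hj => hf j (Finset.mem_insert_of_mem hj))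

theorem hasWirt_apply (p : Fin 3) (z : C3) :
    HasWirt (fun z => z p) (Pi.single (Sum.inl p) 1) z := by
  refine ⟨by fun_prop, fun a => ?_⟩
  have h : fderiv ℝ (fun z : C3 => z p) z = ContinuousLinearMap.proj p :=
    (ContinuousLinearMap.proj (R := ℝ) (φ := fun _ : Fin 3 => ℂ) p).fderiv
  rcases a with q | q <;> simp only [wirtinger, h, ContinuousLinearMap.proj_apply, Pi.single_apply]
  · by_cases hq : p = q
    · subst hq; simp; norm_num
    · simp [hq, Ne.symm hq]
  · by_cases hq : p = q
    · subst hq; simp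
    · simp [hq]

theorem hasWirt_conj_apply (p : Fin 3) (z : C3) :
    HasWirt (fun z => conj (z p)) (Pi.single (Sum.inr p) 1) z := by
  let T : C3 →L[ℝ] ℂ := (Complex.conjCLE : ℂ →L[ℝ] ℂ).comp
    (ContinuousLinearMap.proj (R := ℝ) (φ := fun _ : Fin 3 => ℂ) p)
  have hT : (fun z : C3 => conj (z p)) = T := by ext z; simp [T]
  rw [hT]
  refine ⟨T.differentiableAt, fun a => ?_⟩
  rcases a with q | q <;> simp only [wirtinger, T.fderiv]
  · by_cases hq : p = q
    · subst hq; simp [T]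
    · simp [T, hq]
  · by_cases hq : p = q
    · subst hq; simp [T]; norm_num
    · simp [T, hq, Ne.symm hq]

/-! ### Identities for the metric and `P1` -/

theorem metric_symm (z : C3) (a b : Idx) : metric z a b = metric z b a := by
  have h : ∀ i j, third i j = third j i := by decide
  rcases a with i | i <;> rcases b with j | j <;> simp only [metric]
  · rw [h i j]
    by_cases hij : i = j
    · simp [hij]
    · simp [hij, Ne.symm hij, mul_comm]
  · simp only [eq_comm]
  · simp only [eq_comm]
  · rw [h i j]
    by_cases hij : i = j
    · simp [hij]
    · simp [hij, Ne.symm hij, mul_comm]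

/-- The Wirtinger gradient of `P1`. -/
def gradP1 (z : C3) : Idx → ℂ
  | Sum.inl p => -2 * (z 0*conj (z 0)+z 1*conj (z 1)+z 2*conj (z 2)+1) * conj (z p)
      + 4 * z p * conj (z p) ^ 2 + 4 * (z (p + 1) * z (p + 2))
  | Sum.inr p => -2 * (z 0*conj (z 0)+z 1*conj (z 1)+z 2*conj (z 2)+1) * z p
      + 4 * z p ^ 2 * conj (z p) + 4 * (conj (z (p + 1)) * conj (z (p + 2)))

theorem hasWirt_P1 (z : C3) : HasWirt (fun z => (P1 z : ℂ)) (gradP1 z) z := by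
  simp only [ofReal_P1]
  have u0 := hasWirt_apply 0 z
  have u1 := hasWirt_apply 1 z
  have u2 := hasWirt_apply 2 z
  have v0 := hasWirt_conj_apply 0 z
  have v1 := hasWirt_conj_apply 1 z
  have v2 := hasWirt_conj_apply 2 z
  refine ((((hasWirt_const 2 z).sub (((((u0.mul v0).add (u1.mul v1)).add (u2.mul v2)).add
    (hasWirt_const 1 z)).sq)).add (((((u0.mul v0).sq).add ((u1.mul v1).sq)).add
      ((u2.mul v2).sq)).const_mul 2)).add
      ((((u0.mul u1).mul u2).add ((v0.mul v1).mul v2)).const_mul 4)).congr_deriv ?_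
  have h12 : (1 + 2 : Fin 3) = 0 := rfl
  have h21 : (2 + 1 : Fin 3) = 0 := rfl
  have h22 : (2 + 2 : Fin 3) = 1 := rfl
  have h11 : (1 + 1 : Fin 3) = 2 := rfl
  rintro (p | p) <;> fin_cases p <;>
    simp [gradP1, h12, h21, h22, h11] <;> ring

/-- The boundary equation: the factor `P1` on the right makes `Γ(·, P1)` vanish on the boundary and
cancels the loss of a power in differentiating `P1 ^ β`. -/
theorem sum_metric_gradP1 (z : C3) (a : Idx) :
    ∑ b, metric z a b * gradP1 z b = -3 * coord a z * P1 z := by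
  have h01 : third 0 1 = 2 := rfl
  have h10 : third 1 0 = 2 := rfl
  have h02 : third 0 2 = 1 := rfl
  have h20 : third 2 0 = 1 := rfl
  have h12 : third 1 2 = 0 := rfl
  have h21 : third 2 1 = 0 := rfl
  have k12 : (1 + 2 : Fin 3) = 0 := rfl
  have k21 : (2 + 1 : Fin 3) = 0 := rfl
  have k22 : (2 + 2 : Fin 3) = 1 := rfl
  have k11 : (1 + 1 : Fin 3) = 2 := rfl
  rw [ofReal_P1]
  rcases a with p | p <;> fin_cases p <;>
    simp [Fin.sum_univ_three, metric, gradP1, coord, h01, h10, h02, h20, h12, h21,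
      k12, k21, k22, k11] <;> ring

theorem wirtinger_metric (z : C3) (a b : Idx) :
    HasWirt (fun z => metric z a b) (fun c => wirtinger c (fun z => metric z a b) z) z ∧
    wirtinger a (fun z => metric z a b) z =
      -coord b z * (if a.isLeft = b.isLeft then (if a = b then 2 else 1) else 1 / 2) := by
  suffices h : ∃ d, HasWirt (fun z => metric z a b) d z ∧ d a =
      -coord b z * (if a.isLeft = b.isLeft then (if a = b then 2 else 1) else 1 / 2) by
    obtain ⟨d, h1, h2⟩ := h
    exact ⟨⟨h1.1, fun _ => rfl⟩, (h1.2 a).trans h2⟩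
  have hu := fun p => hasWirt_apply p z
  have hv := fun p => hasWirt_conj_apply p z
  rcases a with i | i <;> rcases b with j | j <;> simp only [metric]
  · by_cases hij : i = j
    · subst hij
      simp only [if_true]
      exact ⟨_, ((hu i).sq).neg, by simp [coord]; ring⟩
    · simp only [hij, if_false]
      exact ⟨_, ((hv (third i j)).const_mul _).sub ((hu i).mul (hu j)), by simp [coord, hij]⟩
  · exact ⟨_, (hasWirt_const _ z).sub (((hu i).mul (hv j)).const_mul _),
      by simp [coord]; ring⟩
  · exact ⟨_, (hasWirt_const _ z).sub (((hu j).mul (hv i)).const_mul _),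
      by simp [coord]; ring⟩
  · by_cases hij : i = j
    · subst hij
      simp only [if_true]
      exact ⟨_, ((hv i).sq).neg, by simp [coord]; ring⟩
    · simp only [hij, if_false]
      exact ⟨_, ((hu (third i j)).const_mul _).sub ((hv i).mul (hv j)), by simp [coord, hij]⟩

/-- The constant is `2 + 1 + 1 + 3 · (1/2)`: diagonal, same-type and mixed entries. -/
theorem sum_wirtinger_metric (z : C3) (b : Idx) :
    ∑ a, wirtinger a (fun z => metric z a b) z = -(11 / 2) * coord b z := by
  simp only [(wirtinger_metric z _ b).2, ← Finset.mul_sum]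
  rcases b with p | p <;> fin_cases p <;> simp [Fin.sum_univ_three] <;> ring

theorem contDiff_P1 : ContDiff ℝ ∞ P1 := by
  have h : P1 = fun z => (2 - (z 0*conj (z 0)+z 1*conj (z 1)+z 2*conj (z 2)+1)^2
      + 2*((z 0*conj (z 0))^2+(z 1*conj (z 1))^2+(z 2*conj (z 2))^2)
      + 4*(z 0*z 1*z 2+conj (z 0)*conj (z 1)*conj (z 2)) : ℂ).re := by
    ext z; rw [← ofReal_P1, Complex.ofReal_re]
  rw [h]
  have hu : ∀ p : Fin 3, ContDiff ℝ ∞ fun z : C3 => z p := fun p => contDiff_apply ℝ ℂ p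
  have hv : ∀ p : Fin 3, ContDiff ℝ ∞ fun z : C3 => conj (z p) := fun p =>
    Complex.conjCLE.contDiff.comp (hu p)
  have u0 := hu 0
  have u1 := hu 1
  have u2 := hu 2
  have v0 := hv 0
  have v1 := hv 1
  have v2 := hv 2
  have h2 : ContDiff ℝ ∞ fun z : C3 =>
      (2 - (z 0*conj (z 0)+z 1*conj (z 1)+z 2*conj (z 2)+1)^2
      + 2*((z 0*conj (z 0))^2+(z 1*conj (z 1))^2+(z 2*conj (z 2))^2)
      + 4*(z 0*z 1*z 2+conj (z 0)*conj (z 1)*conj (z 2)) : ℂ) := by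
    fun_prop
  exact Complex.reCLM.contDiff.comp h2

theorem hasWirt_comp_P1 {h : ℝ → ℝ} {h' : ℝ} {z : C3} (hh : HasDerivAt h h' (P1 z)) :
    HasWirt (fun z => (h (P1 z) : ℂ)) (fun a => h' * gradP1 z a) z := by
  have hP : HasFDerivAt P1 (fderiv ℝ P1 z) z :=
    (contDiff_P1.differentiable (by simp) z).hasFDerivAt
  have h1 : HasFDerivAt (fun z => (h (P1 z) : ℂ))
      (Complex.ofRealCLM.comp (h' • fderiv ℝ P1 z)) z :=
    Complex.ofRealCLM.hasFDerivAt.comp z (hh.comp_hasFDerivAt z hP)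
  have h2 : HasFDerivAt (fun z => (P1 z : ℂ)) (Complex.ofRealCLM.comp (fderiv ℝ P1 z)) z :=
    Complex.ofRealCLM.hasFDerivAt.comp z hP
  refine ⟨h1.differentiableAt, fun a => ?_⟩
  beta_reduce
  rw [← (hasWirt_P1 z).2 a]
  cases a <;> simp only [wirtinger, h1.fderiv, h2.fderiv, ContinuousLinearMap.comp_apply,
    smul_apply, smul_eq_mul, Complex.ofRealCLM_apply, Complex.ofReal_mul] <;> ring

theorem contDiffAt_wirtinger {f : C3 → ℂ} {z : C3} (hf : ContDiffAt ℝ ∞ f z) (a : Idx) :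
    ContDiffAt ℝ ∞ (wirtinger a f) z := by
  have h : ContDiffAt ℝ ∞ (fderiv ℝ f) z := hf.fderiv_right (by simp)
  have hv : ∀ v : C3, ContDiffAt ℝ ∞ (fun z => fderiv ℝ f z v) z := fun v =>
    h.clm_apply contDiffAt_const
  rcases a with p | p
  · exact contDiffAt_const.mul ((hv _).sub (contDiffAt_const.mul (hv _)))
  · exact contDiffAt_const.mul ((hv _).add (contDiffAt_const.mul (hv _)))

theorem contDiff_coord (a : Idx) : ContDiff ℝ ∞ (coord a) := by
  rcases a with p | p
  · exact contDiff_apply ℝ ℂ p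
  · exact Complex.conjCLE.contDiff.comp (contDiff_apply ℝ ℂ p)

theorem contDiff_metric (a b : Idx) : ContDiff ℝ ∞ fun z => metric z a b := by
  have hu : ∀ p : Fin 3, ContDiff ℝ ∞ fun z : C3 => z p := fun p => contDiff_coord (Sum.inl p)
  have hv : ∀ p : Fin 3, ContDiff ℝ ∞ fun z : C3 => conj (z p) := fun p =>
    contDiff_coord (Sum.inr p)
  rcases a with i | i <;> rcases b with j | j <;> simp only [metric]
  · split_ifs
    · exact ((hu i).pow 2).neg
    · exact (contDiff_const.mul (hv _)).sub ((hu i).mul (hu j))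
  · exact contDiff_const.sub (contDiff_const.mul ((hu i).mul (hv j)))
  · exact contDiff_const.sub (contDiff_const.mul ((hu j).mul (hv i)))
  · split_ifs
    · exact ((hv i).pow 2).neg
    · exact (contDiff_const.mul (hu _)).sub ((hv i).mul (hv j))

/-! ### Divergence of the weighted flux -/

/-- The Euler field `∑ u_a ∂_a`. -/
def euler (f : C3 → ℂ) (z : C3) : ℂ := ∑ a : Idx, coord a z * wirtinger a f z

theorem contDiffAt_euler {f : C3 → ℂ} {z : C3} (hf : ContDiffAt ℝ ∞ f z) :
    ContDiffAt ℝ ∞ (euler f) z :=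
  ContDiffAt.sum fun a _ => (contDiff_coord a).contDiffAt.mul (contDiffAt_wirtinger hf a)

theorem contDiffAt_Gam {f g : C3 → ℂ} {z : C3} (hf : ContDiffAt ℝ ∞ f z)
    (hg : ContDiffAt ℝ ∞ g z) : ContDiffAt ℝ ∞ (Gam f g) z :=
  ContDiffAt.sum fun a _ => ContDiffAt.sum fun b _ => (contDiff_metric a b).contDiffAt.mul
    ((contDiffAt_wirtinger hf a).mul (contDiffAt_wirtinger hg b))

theorem contDiffAt_Lhat (lam : ℝ) {f : C3 → ℂ} {z : C3} (hf : ContDiffAt ℝ ∞ f z) :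
    ContDiffAt ℝ ∞ (Lhat lam f) z :=
  (ContDiffAt.sum fun a _ => ContDiffAt.sum fun b _ => (contDiff_metric a b).contDiffAt.mul
    (contDiffAt_wirtinger (contDiffAt_wirtinger hf b) a)).add
    (ContDiffAt.sum fun a _ => (contDiffAt_const.mul (contDiff_coord a).contDiffAt).mul
      (contDiffAt_wirtinger hf a))

theorem Lhat_eq (lam : ℝ) (f : C3 → ℂ) (z : C3) :
    Lhat lam f z = (∑ a : Idx, ∑ b : Idx, metric z a b * wirtinger a (wirtinger b f) z)
      - lam * euler f z := by
  rw [Lhat, euler, Finset.mul_sum, sub_eq_add_neg, ← Finset.sum_neg_distrib]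
  congr 1
  exact Finset.sum_congr rfl fun a _ => by ring

theorem Gam_comm (f g : C3 → ℂ) (z : C3) : Gam f g z = Gam g f z := by
  rw [Gam, Finset.sum_comm]
  refine Finset.sum_congr rfl fun a _ => Finset.sum_congr rfl fun b _ => ?_
  rw [metric_symm z b a]; ring

/-- The components of the vector field `h(P1) f Γ(·, g)`. -/
def flux (h : ℝ → ℝ) (f g : C3 → ℂ) (a : Idx) (z : C3) : ℂ :=
  (h (P1 z) : ℂ) * (f z * ∑ b : Idx, metric z a b * wirtinger b g z)

/-- The value `11/2` is the drift produced by Lebesgue measure alone; the weight enters only through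
`P1 h'`. -/
theorem sum_wirtinger_flux {h : ℝ → ℝ} {h' : ℝ} {f g : C3 → ℂ} {z : C3}
    (hh : HasDerivAt h h' (P1 z)) (hf : ContDiffAt ℝ ∞ f z) (hg : ContDiffAt ℝ ∞ g z) :
    ∑ a, wirtinger a (flux h f g a) z =
      h (P1 z) * (Gam f g z + f z * Lhat (11 / 2) g z)
        - 3 * (P1 z * h' : ℝ) * (f z * euler g z) := by
  have hV : ∀ a, HasWirt (fun z => ∑ b : Idx, metric z a b * wirtinger b g z) _ z := fun a =>
    HasWirt.sum Finset.univ fun b _ => (wirtinger_metric z a b).1.mul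
      (DifferentiableAt.hasWirt ((contDiffAt_wirtinger hg b).differentiableAt (by simp)))
  have hF : ∀ a, HasWirt (flux h f g a) _ z := fun a => (hasWirt_comp_P1 hh).mul
    ((DifferentiableAt.hasWirt (hf.differentiableAt (by simp))).mul (hV a))
  simp only [(hF _).2]
  have e1 : ∑ a, gradP1 z a * ∑ b : Idx, metric z a b * wirtinger b g z
      = -3 * P1 z * euler g z := by
    simp only [Finset.mul_sum, euler]
    rw [Finset.sum_comm]
    refine Finset.sum_congr rfl fun b _ => ?_
    rw [show -3 * (P1 z : ℂ) * (coord b z * wirtinger b g z)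
      = (-3 * coord b z * P1 z) * wirtinger b g z by ring, ← sum_metric_gradP1, Finset.sum_mul]
    exact Finset.sum_congr rfl fun a _ => by rw [metric_symm z b a]; ring
  have e2 : ∑ a, wirtinger a f z * ∑ b : Idx, metric z a b * wirtinger b g z = Gam f g z := by
    simp only [Finset.mul_sum, Gam]
    exact Finset.sum_congr rfl fun a _ => Finset.sum_congr rfl fun b _ => by ring
  have e3 : ∑ a, ∑ b : Idx, (wirtinger a (fun z => metric z a b) z * wirtinger b g z
      + metric z a b * wirtinger a (wirtinger b g) z) = Lhat (11 / 2) g z := by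
    simp only [Finset.sum_add_distrib]
    rw [Lhat_eq, Finset.sum_comm]
    simp only [← Finset.sum_mul, sum_wirtinger_metric, euler, Finset.mul_sum]
    rw [add_comm, sub_eq_add_neg, ← Finset.sum_neg_distrib]
    congr 1
    refine Finset.sum_congr rfl fun a _ => ?_
    push_cast
    ring
  rw [Finset.sum_congr rfl fun a _ => (by ring :
    (h' : ℂ) * gradP1 z a * (f z * ∑ b, metric z a b * wirtinger b g z) +
        (h (P1 z) : ℂ) * (wirtinger a f z * ∑ b, metric z a b * wirtinger b g z +
          f z * ∑ b, (wirtinger a (fun z => metric z a b) z * wirtinger b g z +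
            metric z a b * wirtinger a (wirtinger b g) z)) =
      (h' * f z) * (gradP1 z a * ∑ b, metric z a b * wirtinger b g z) +
        ((h (P1 z) : ℂ) * (wirtinger a f z * ∑ b, metric z a b * wirtinger b g z) +
          (h (P1 z) * f z) * ∑ b, (wirtinger a (fun z => metric z a b) z * wirtinger b g z +
            metric z a b * wirtinger a (wirtinger b g) z)))]
  rw [Finset.sum_add_distrib, Finset.sum_add_distrib, ← Finset.mul_sum, ← Finset.mul_sum,
    ← Finset.mul_sum, e1, e2, e3]
  push_cast
  ring

/-! ### Integration by parts with a cutoff -/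

theorem integral_fderiv_apply_eq_zero {H : C3 → ℂ} (hH : ContDiff ℝ 1 H)
    (hc : HasCompactSupport H) (v : C3) :
    Integrable (fun z => fderiv ℝ H z v) ∧ ∫ z, fderiv ℝ H z v = 0 := by
  have hi : Integrable (fun z => fderiv ℝ H z v) := by
    refine Continuous.integrable_of_hasCompactSupport
      ((hH.continuous_fderiv one_ne_zero).clm_apply continuous_const) ?_
    exact (hc.fderiv ℝ).comp_left (g := fun T : C3 →L[ℝ] ℂ => T v) rfl
  refine ⟨hi, ?_⟩
  have h := integral_mul_fderiv_eq_neg_fderiv_mul_of_integrable (μ := (volume : Measure C3))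
    (f := fun _ : C3 => (1 : ℂ)) (g := H) (v := v) (by simp) (by simpa using hi)
    (by simpa using hH.continuous.integrable_of_hasCompactSupport hc)
    (fun _ _ => by fun_prop) (fun z _ => hH.differentiable one_ne_zero z)
  simpa using h

theorem integral_wirtinger_eq_zero {H : C3 → ℂ} (hH : ContDiff ℝ 1 H)
    (hc : HasCompactSupport H) (a : Idx) :
    Integrable (wirtinger a H) ∧ ∫ z, wirtinger a H z = 0 := by
  rcases a with p | p
  · obtain ⟨h1, h1'⟩ := integral_fderiv_apply_eq_zero hH hc (Pi.single p 1)
    obtain ⟨h2, h2'⟩ := integral_fderiv_apply_eq_zero hH hc (Pi.single p Complex.I)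
    refine ⟨(h1.sub (h2.const_mul _)).const_mul _, ?_⟩
    simp only [wirtinger]
    rw [integral_const_mul, integral_sub h1 (h2.const_mul _), integral_const_mul, h1', h2']
    simp
  · obtain ⟨h1, h1'⟩ := integral_fderiv_apply_eq_zero hH hc (Pi.single p 1)
    obtain ⟨h2, h2'⟩ := integral_fderiv_apply_eq_zero hH hc (Pi.single p Complex.I)
    refine ⟨(h1.add (h2.const_mul _)).const_mul _, ?_⟩
    simp only [wirtinger]
    rw [integral_const_mul, integral_add h1 (h2.const_mul _), integral_const_mul, h1', h2']
    simp

theorem IsTestFunction.contDiffAt {f : C3 → ℂ} (hf : IsTestFunction f) {z : C3}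
    (hz : z ∈ closure Omega1) : ContDiffAt ℝ ∞ f z := by
  obtain ⟨U, hU, hsub, hfU⟩ := hf
  exact hfU.contDiffAt (hU.mem_nhds (hsub hz))

theorem contDiffAt_flux {h : ℝ → ℝ} {f g : C3 → ℂ} {z : C3} (hh : ContDiffAt ℝ 1 h (P1 z))
    (hf : ContDiffAt ℝ ∞ f z) (hg : ContDiffAt ℝ ∞ g z) (a : Idx) :
    ContDiffAt ℝ 1 (flux h f g a) z := by
  refine ContDiffAt.mul ?_ ((hf.mul (ContDiffAt.sum fun b _ =>
    (contDiff_metric a b).contDiffAt.mul (contDiffAt_wirtinger hg b))).of_le (by simp))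
  exact Complex.ofRealCLM.contDiff.contDiffAt.comp z
    (hh.comp z (contDiff_P1.contDiffAt.of_le (by simp)))

theorem indicator_flux_eventuallyEq_zero {h : ℝ → ℝ} {ε : ℝ} (hε : 0 < ε)
    (h0 : ∀ t ≤ ε, h t = 0) (f g : C3 → ℂ) (a : Idx) {z : C3} (hz : z ∉ Omega1) :
    Omega1.indicator (flux h f g a) =ᶠ[nhds z] fun _ => 0 := by
  by_cases hc : z ∈ closure Omega1
  · have hP := P1_eq_zero_of_mem_closure hc hz
    filter_upwards [continuous_P1.continuousAt.eventually_lt_const (hP ▸ hε : P1 z < ε)]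
      with w hw
    simp [flux, h0 _ hw.le]
  · filter_upwards [isClosed_closure.isOpen_compl.mem_nhds hc] with w hw
    exact Set.indicator_of_notMem (fun h => hw (subset_closure h)) _

theorem indicator_eventuallyEq {H : C3 → ℂ} {z : C3} (hz : z ∈ Omega1) :
    Omega1.indicator H =ᶠ[nhds z] H := by
  filter_upwards [isOpen_Omega1.mem_nhds hz] with w hw
  exact Set.indicator_of_mem hw _

/-- Near the boundary `P1 < ε`, so the flux extended by zero is `C¹` with compact support and its
divergence integrates to zero. -/
theorem integral_cutoff {h : ℝ → ℝ} {ε : ℝ} (hε : 0 < ε) (h0 : ∀ t ≤ ε, h t = 0)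
    (hh : ∀ t, 0 < t → ContDiffAt ℝ 1 h t) {f g : C3 → ℂ} (hf : IsTestFunction f)
    (hg : IsTestFunction g) :
    ∫ z in Omega1, ((h (P1 z) : ℂ) * (Gam f g z + f z * Lhat (11 / 2) g z)
        - 3 * (P1 z * deriv h (P1 z) : ℝ) * (f z * euler g z)) = 0 := by
  have hfz := fun z hz => hf.contDiffAt (z := z) (subset_closure hz)
  have hgz := fun z hz => hg.contDiffAt (z := z) (subset_closure hz)
  have hC : ∀ a, ContDiff ℝ 1 (Omega1.indicator (flux h f g a)) := by
    intro a
    rw [contDiff_iff_contDiffAt]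
    intro z
    by_cases hz : z ∈ Omega1
    · exact (contDiffAt_flux (hh _ (P1_pos hz)) (hfz z hz) (hgz z hz) a).congr_of_eventuallyEq
        (indicator_eventuallyEq hz)
    · exact contDiffAt_const.congr_of_eventuallyEq
        (indicator_flux_eventuallyEq_zero hε h0 f g a hz)
  have hS : ∀ a, HasCompactSupport (Omega1.indicator (flux h f g a)) := fun a =>
    HasCompactSupport.of_support_subset_isCompact isCompact_closure_Omega1
      (Set.support_indicator_subset.trans subset_closure)
  have hI := fun a => integral_wirtinger_eq_zero (hC a) (hS a) a
  have hsum : ∫ z, ∑ a, wirtinger a (Omega1.indicator (flux h f g a)) z = 0 := by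
    rw [integral_finsetSum _ fun a _ => (hI a).1]
    exact Finset.sum_eq_zero fun a _ => (hI a).2
  rw [← hsum, ← integral_indicator isOpen_Omega1.measurableSet]
  refine integral_congr_ae (Filter.Eventually.of_forall fun z => ?_)
  by_cases hz : z ∈ Omega1
  · simp only [Set.indicator_of_mem hz, fun a => wirtinger_congr
      (indicator_eventuallyEq (H := flux h f g a) hz) a]
    exact (sum_wirtinger_flux ((hh _ (P1_pos hz)).differentiableAt one_ne_zero).hasDerivAt
      (hfz z hz) (hgz z hz)).symm
  · simp only [Set.indicator_of_notMem hz, fun a => wirtinger_congr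
      (indicator_flux_eventuallyEq_zero hε h0 f g a hz) a, (hasWirt_const 0 z).2]
    simp

/-! ### Removing the cutoff -/

/-- A smooth function that is `0` on `(-∞, 1]` and `1` on `[2, ∞)`. -/
def smoothStep (s : ℝ) : ℝ := Real.smoothTransition (s - 1)

theorem contDiff_smoothStep : ContDiff ℝ ∞ smoothStep :=
  Real.smoothTransition.contDiff.comp (contDiff_id.sub contDiff_const)

theorem smoothStep_eq_zero {s : ℝ} (hs : s ≤ 1) : smoothStep s = 0 :=
  Real.smoothTransition.zero_of_nonpos (by linarith)

theorem smoothStep_eq_one {s : ℝ} (hs : 2 ≤ s) : smoothStep s = 1 :=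
  Real.smoothTransition.one_of_one_le (by linarith)

theorem abs_smoothStep_le (s : ℝ) : |smoothStep s| ≤ 1 := by
  rw [smoothStep, abs_of_nonneg (Real.smoothTransition.nonneg _)]
  exact Real.smoothTransition.le_one _

theorem deriv_smoothStep_of_gt {s : ℝ} (hs : 2 < s) : deriv smoothStep s = 0 := by
  have : smoothStep =ᶠ[nhds s] fun _ => 1 := by
    filter_upwards [lt_mem_nhds hs] with t ht using smoothStep_eq_one ht.le
  rw [this.deriv_eq, deriv_const]

theorem deriv_smoothStep_of_lt {s : ℝ} (hs : s < 1) : deriv smoothStep s = 0 := by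
  have : smoothStep =ᶠ[nhds s] fun _ => 0 := by
    filter_upwards [gt_mem_nhds hs] with t ht using smoothStep_eq_zero ht.le
  rw [this.deriv_eq, deriv_const]

theorem exists_mul_deriv_smoothStep_le : ∃ M, ∀ s, |s * deriv smoothStep s| ≤ M := by
  have hc : Continuous fun s => s * deriv smoothStep s :=
    continuous_id.mul (contDiff_smoothStep.continuous_deriv (by simp))
  obtain ⟨M, hM⟩ := (isCompact_Icc (a := (1 : ℝ)) (b := 2)).exists_bound_of_continuousOn
    hc.continuousOn
  refine ⟨max M 0, fun s => ?_⟩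
  rcases lt_or_ge s 1 with h | h
  · simp [deriv_smoothStep_of_lt h]
  rcases lt_or_ge 2 s with h' | h'
  · simp [deriv_smoothStep_of_gt h']
  · exact (hM s ⟨h, h'⟩).trans (le_max_left _ _)

theorem contDiffAt_cutoff_rpow (N β : ℝ) {t : ℝ} (ht : 0 < t) :
    ContDiffAt ℝ 1 (fun t => smoothStep (N * t) * t ^ β) t := by
  refine ContDiffAt.mul ?_ (Real.contDiffAt_rpow_const_of_ne ht.ne')
  exact (contDiff_smoothStep.of_le (by simp)).contDiffAt.comp t (by fun_prop)

theorem mul_deriv_cutoff_rpow (N β : ℝ) {t : ℝ} (ht : 0 < t) :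
    t * deriv (fun t => smoothStep (N * t) * t ^ β) t =
      (N * t * deriv smoothStep (N * t) + β * smoothStep (N * t)) * t ^ β := by
  have h1 : HasDerivAt (fun t => smoothStep (N * t)) (deriv smoothStep (N * t) * N) t := by
    have h := (contDiff_smoothStep.differentiable (by simp) (N * t)).hasDerivAt
    have h' : HasDerivAt (fun t => N * t) N t := by simpa using (hasDerivAt_id t).const_mul N
    exact h.comp t h'
  have h2 : HasDerivAt (fun t => t ^ β) (β * t ^ (β - 1)) t :=
    Real.hasDerivAt_rpow_const (Or.inl ht.ne')
  rw [(h1.fun_mul h2).deriv, Real.rpow_sub_one ht.ne']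
  field_simp

theorem integral_rpow_mul_bounded {β : ℝ} (hβ : -1 < β) {G : C3 → ℂ}
    (hG : ∀ z ∈ closure Omega1, ContinuousAt G z) :
    Integrable (fun z => ((P1 z ^ β : ℝ) : ℂ) * G z) (volume.restrict Omega1) := by
  have hcont : ContinuousOn G (closure Omega1) := fun z hz => (hG z hz).continuousWithinAt
  obtain ⟨C, hC⟩ := isCompact_closure_Omega1.exists_bound_of_continuousOn hcont
  refine (integrableOn_P1_rpow hβ).ofReal.mul_bdd (c := C)
    ((hcont.mono subset_closure).aestronglyMeasurable isOpen_Omega1.measurableSet) ?_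
  exact (ae_restrict_iff' isOpen_Omega1.measurableSet).2
    (Filter.Eventually.of_forall fun z hz => hC z (subset_closure hz))

/-- Used with `w = smoothStep`, `c = 1` for the main term and `w s = s * deriv smoothStep s`, `c =
0` for the cutoff error. -/
theorem tendsto_integral_weight {β : ℝ} (hβ : -1 < β) {G : C3 → ℂ}
    (hG : ∀ z ∈ closure Omega1, ContinuousAt G z) {w : ℝ → ℝ} (hw : Continuous w) {M c : ℝ}
    (hM : ∀ s, |w s| ≤ M) (hc : ∀ s, 2 < s → w s = c) :
    Filter.Tendsto (fun n : ℕ => ∫ z in Omega1,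
        (w ((n + 1 : ℝ) * P1 z) : ℂ) * (((P1 z ^ β : ℝ) : ℂ) * G z)) Filter.atTop
      (nhds (∫ z in Omega1, (c : ℂ) * (((P1 z ^ β : ℝ) : ℂ) * G z))) := by
  have hI := integral_rpow_mul_bounded hβ hG
  refine tendsto_integral_of_dominated_convergence
    (fun z => M * ‖((P1 z ^ β : ℝ) : ℂ) * G z‖) ?_ (hI.norm.const_mul M) ?_ ?_
  · intro n
    have : Continuous fun z => (w ((n + 1 : ℝ) * P1 z) : ℂ) :=
      Complex.continuous_ofReal.comp (hw.comp (continuous_const.mul continuous_P1))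
    exact this.aestronglyMeasurable.mul hI.aestronglyMeasurable
  · intro n
    refine Filter.Eventually.of_forall fun z => ?_
    rw [norm_mul, Complex.norm_real]
    exact mul_le_mul_of_nonneg_right (hM _) (norm_nonneg _)
  · refine (ae_restrict_iff' isOpen_Omega1.measurableSet).2
      (Filter.Eventually.of_forall fun z hz => ?_)
    refine tendsto_const_nhds.congr' ?_
    have hP := P1_pos hz
    have ht : Filter.Tendsto (fun n : ℕ => ((n : ℝ) + 1) * P1 z) Filter.atTop Filter.atTop :=
      (Filter.tendsto_atTop_add_const_right _ _ tendsto_natCast_atTop_atTop).atTop_mul_const hP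
    filter_upwards [ht.eventually_gt_atTop 2] with n hn
    rw [hc _ hn]

theorem integral_rpow_Gam_add {lam : ℝ} (hlam : 5 / 2 < lam) {f g : C3 → ℂ}
    (hf : IsTestFunction f) (hg : IsTestFunction g) :
    ∫ z in Omega1, ((P1 z ^ ((2 * lam - 11) / 6) : ℝ) : ℂ) *
      (Gam f g z + f z * Lhat lam g z) = 0 := by
  set β := (2 * lam - 11) / 6 with hβ_def
  have hβ : -1 < β := by rw [hβ_def]; linarith
  have hlamβ : lam = 11 / 2 + 3 * β := by rw [hβ_def]; ring
  have hG : ∀ z ∈ closure Omega1, ContinuousAt (fun z => Gam f g z + f z * Lhat lam g z) z :=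
    fun z hz => ((contDiffAt_Gam (hf.contDiffAt hz) (hg.contDiffAt hz)).add
      ((hf.contDiffAt hz).mul (contDiffAt_Lhat lam (hg.contDiffAt hz)))).continuousAt
  have hE : ∀ z ∈ closure Omega1, ContinuousAt (fun z => f z * euler g z) z :=
    fun z hz => ((hf.contDiffAt hz).mul (contDiffAt_euler (hg.contDiffAt hz))).continuousAt
  obtain ⟨M, hM⟩ := exists_mul_deriv_smoothStep_le
  have hw2 : Continuous fun s => s * deriv smoothStep s :=
    continuous_id.mul (contDiff_smoothStep.continuous_deriv (by simp))
  have t1 := tendsto_integral_weight hβ hG contDiff_smoothStep.continuous abs_smoothStep_le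
    (fun s hs => smoothStep_eq_one hs.le)
  have t2 := (tendsto_integral_weight hβ hE hw2 hM
    (c := 0) (fun s hs => by rw [deriv_smoothStep_of_gt hs, mul_zero])).const_mul 3
  simp only [Complex.ofReal_one, one_mul, Complex.ofReal_zero, zero_mul, integral_zero,
    mul_zero] at t1 t2
  refine tendsto_nhds_unique t1 (t2.congr fun n => ?_)
  have hN : (0 : ℝ) < n + 1 := by positivity
  have h := integral_cutoff (h := fun t => smoothStep ((n + 1) * t) * t ^ β)
    (ε := 1 / (n + 1)) (by positivity) (fun t ht => by
      rw [le_div_iff₀ hN] at ht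
      rw [smoothStep_eq_zero (by linarith), zero_mul])
    (fun t ht => contDiffAt_cutoff_rpow _ β ht) hf hg
  have hb : ∀ {G : C3 → ℂ} (_ : ∀ z ∈ closure Omega1, ContinuousAt G z) {w : ℝ → ℝ}
      (_ : Continuous w) {M : ℝ} (_ : ∀ s, |w s| ≤ M),
      IntegrableOn (fun z => (w ((n + 1 : ℝ) * P1 z) : ℂ) * (((P1 z ^ β : ℝ) : ℂ) * G z))
        Omega1 := by
    intro G hG w hw M hM
    refine (integral_rpow_mul_bounded hβ hG).bdd_mul (c := M) ?_
      (Filter.Eventually.of_forall fun z => ?_)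
    · exact (Complex.continuous_ofReal.comp
        (hw.comp (continuous_const.mul continuous_P1))).aestronglyMeasurable
    · rw [Complex.norm_real]
      exact hM _
  have i1 := hb hG contDiff_smoothStep.continuous abs_smoothStep_le
  have i2 := hb hE hw2 hM
  rw [eq_comm, ← sub_eq_zero, ← integral_const_mul, ← integral_sub i1 (i2.const_mul 3), ← h]
  refine setIntegral_congr_fun isOpen_Omega1.measurableSet fun z hz => ?_
  -- The `β` part of `t h'` turns the drift `11/2` into `11/2 + 3β = lam`; the part with `deriv
  -- smoothStep` is the error integrand.
  rw [mul_deriv_cutoff_rpow _ β (P1_pos hz), Lhat_eq, Lhat_eq, hlamβ]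
  push_cast
  ring

/-! ### The probability measure and reversibility -/

theorem normConst_pos {β : ℝ} (hβ : -1 < β) : 0 < normConst β := by
  refine inv_pos.2 ?_
  have hpos : ∀ z ∈ Omega1, 0 < P1 z ^ β := fun z hz => Real.rpow_pos_of_pos (P1_pos hz) β
  rw [setIntegral_pos_iff_support_of_nonneg_ae
    ((ae_restrict_iff' isOpen_Omega1.measurableSet).2
      (Filter.Eventually.of_forall fun z hz => (hpos z hz).le)) (integrableOn_P1_rpow hβ)]
  have hsub : Omega1 ⊆ Function.support fun z => P1 z ^ β := fun z hz => (hpos z hz).ne'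
  rw [Set.inter_eq_self_of_subset_right hsub]
  exact isOpen_Omega1.measure_pos _ ⟨0, zero_mem_Omega1⟩

theorem isProbabilityMeasure_mu {β : ℝ} (hβ : -1 < β) : IsProbabilityMeasure (mu β) := by
  refine ⟨?_⟩
  have hn := normConst_pos hβ
  rw [mu, withDensity_apply _ MeasurableSet.univ, Measure.restrict_univ,
    ← ofReal_integral_eq_lintegral_ofReal ((integrableOn_P1_rpow hβ).const_mul _)
    ((ae_restrict_iff' isOpen_Omega1.measurableSet).2 (Filter.Eventually.of_forall fun z hz =>
      mul_nonneg hn.le (Real.rpow_nonneg (P1_pos hz).le _)))]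
  rw [integral_const_mul, normConst, inv_mul_cancel₀ (inv_pos.1 hn).ne', ENNReal.ofReal_one]

theorem measurable_density (β : ℝ) :
    Measurable fun z => ENNReal.ofReal (normConst β * P1 z ^ β) :=
  ((continuous_P1.measurable.pow_const β).const_mul _).ennreal_ofReal

theorem toReal_density_smul {β : ℝ} (hβ : -1 < β) (G : C3 → ℂ) {z : C3} (hz : z ∈ Omega1) :
    (ENNReal.ofReal (normConst β * P1 z ^ β)).toReal • G z =
      (normConst β : ℂ) * (((P1 z ^ β : ℝ) : ℂ) * G z) := by
  rw [ENNReal.toReal_ofReal (mul_nonneg (normConst_pos hβ).le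
    (Real.rpow_nonneg (P1_pos hz).le _)), Complex.real_smul, Complex.ofReal_mul, mul_assoc]

theorem integral_mu {β : ℝ} (hβ : -1 < β) (G : C3 → ℂ) :
    ∫ z, G z ∂(mu β) = normConst β * ∫ z in Omega1, ((P1 z ^ β : ℝ) : ℂ) * G z := by
  rw [mu, integral_withDensity_eq_integral_toReal_smul (measurable_density β)
    (Filter.Eventually.of_forall fun _ => ENNReal.ofReal_lt_top), ← integral_const_mul]
  exact setIntegral_congr_fun isOpen_Omega1.measurableSet fun z hz => toReal_density_smul hβ G hz

theorem integrable_mu {β : ℝ} (hβ : -1 < β) {G : C3 → ℂ}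
    (hG : ∀ z ∈ closure Omega1, ContinuousAt G z) : Integrable G (mu β) := by
  rw [mu, integrable_withDensity_iff_integrable_smul' (measurable_density β)
    (Filter.Eventually.of_forall fun _ => ENNReal.ofReal_lt_top)]
  refine ((integral_rpow_mul_bounded hβ hG).const_mul (normConst β : ℂ)).congr ?_
  exact (ae_restrict_iff' isOpen_Omega1.measurableSet).2
    (Filter.Eventually.of_forall fun z hz => (toReal_density_smul hβ G hz).symm)

theorem integral_mul_Lhat {lam : ℝ} (hlam : 5 / 2 < lam) {f g : C3 → ℂ}
    (hf : IsTestFunction f) (hg : IsTestFunction g) :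
    ∫ z, f z * Lhat lam g z ∂(mu ((2 * lam - 11) / 6)) =
      -∫ z, Gam f g z ∂(mu ((2 * lam - 11) / 6)) := by
  have hβ : -1 < (2 * lam - 11) / 6 := by linarith
  have hG : ∀ z ∈ closure Omega1, ContinuousAt (Gam f g) z := fun z hz =>
    (contDiffAt_Gam (hf.contDiffAt hz) (hg.contDiffAt hz)).continuousAt
  have hL : ∀ z ∈ closure Omega1, ContinuousAt (fun z => f z * Lhat lam g z) z := fun z hz =>
    ((hf.contDiffAt hz).mul (contDiffAt_Lhat lam (hg.contDiffAt hz))).continuousAt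
  rw [eq_neg_iff_add_eq_zero, add_comm,
    ← integral_add (integrable_mu hβ hG) (integrable_mu hβ hL), integral_mu hβ,
    integral_rpow_Gam_add hlam hf hg, mul_zero]

theorem isReversible_mu {lam : ℝ} (hlam : 5 / 2 < lam) :
    IsReversible (Lhat lam) Gam (mu ((2 * lam - 11) / 6)) := by
  intro f g hf hg
  have hβ : -1 < (2 * lam - 11) / 6 := by linarith
  refine ⟨integrable_mu hβ fun z hz =>
      ((hf.contDiffAt hz).mul (contDiffAt_Lhat lam (hg.contDiffAt hz))).continuousAt,
    integrable_mu hβ fun z hz =>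
      ((contDiffAt_Lhat lam (hf.contDiffAt hz)).mul (hg.contDiffAt hz)).continuousAt,
    integrable_mu hβ fun z hz =>
      (contDiffAt_Gam (hf.contDiffAt hz) (hg.contDiffAt hz)).continuousAt, ?_,
    integral_mul_Lhat hlam hf hg⟩
  simp only [mul_comm (Lhat lam f _)]
  rw [integral_mul_Lhat hlam hf hg, integral_mul_Lhat hlam hg hf]
  simp only [Gam_comm f g]

end DeltoidModel

end

theorem mainTheorem4 :
    (∀ z ∈ DeltoidModel.Omega1, 0 < DeltoidModel.P1 z) ∧
    (∀ β : ℝ, -1 < β →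
      IntegrableOn (fun z => DeltoidModel.P1 z ^ β) DeltoidModel.Omega1 volume) ∧
    (∀ lam : ℝ, 5 / 2 < lam →
      IsProbabilityMeasure (DeltoidModel.mu ((2 * lam - 11) / 6)) ∧
      DeltoidModel.IsReversible (DeltoidModel.Lhat lam) DeltoidModel.Gam
        (DeltoidModel.mu ((2 * lam - 11) / 6))) :=
  ⟨fun _ hz => DeltoidModel.P1_pos hz, fun _ hβ => DeltoidModel.integrableOn_P1_rpow hβ,
    fun _ hlam => ⟨DeltoidModel.isProbabilityMeasure_mu (by linarith),
      DeltoidModel.isReversible_mu hlam⟩⟩
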